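/- **Security of the full SmartOTPs scheme.** Let $P, N_S, N$ be positive integers with $P \mid N_S \mid N$, let $S\ge 0$ be an integer and $\mathcal L_S = N_S/P$. *Scheme.* Let $h_1,\dots,h_P : \{0,1\}^S \to \{0,1\}^S$ be independent uniformly random functions (a random oracle with domain separation, $h_m(x)=h(m\,\|\,x)$, the same functions being used in all chains) and let $F(0),\dots,F(N/P-1)\in\{0,1\}^S$ be independent uniformly random words. The $c$-th hash chain starts at $F(c)$ and applies $h_1,\dots,h_P$ in turn; its end, the item after $P$ steps, is the leaf of the chain. The one-time password of operation $i$ ($0\le i<N$) is $$OTP_i = h_{\alpha(i)}\circ\cdots\circ h_1\big(F(\beta(i))\big),\quad \alpha(i) = P - \Big\lfloor \tfrac{(i \bmod N_S)P}{N_S}\Big\rfloor - 1,\quad \beta(i) = \Big\lfloor \tfrac{i}{N_S}\Big\rfloor\mathcal L_S + (i \bmod \mathcal L_S),$$ and a word $z$ is accepted for operation $i$ if $h_P\circ\cdots\circ h_{\alpha(i)+1}(z)$ is the leaf of chain $\beta(i)$. Operations $\delta N_S,\dots,(\delta+1)N_S-1$ form subtree $\delta$; it uses $\mathcal L_S$ chains,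 in $P$ successive iteration layers of $\mathcal L_S$ operations each. *Attack.* Fix a subtree $\delta$, $0\le\delta<N/N_S$. A (computationally unbounded, randomized, adaptive) adversary $\mathcal A$ receives the leaves of subtree $\delta$ and the first items $F(c)$ of all chains of the earlier subtrees. It makes at most $Q$ queries to the functions $h_m$, and may at any moment ask that the next iteration layer of OTPs of subtree $\delta$ be disclosed. It finally outputs an operation $i$ of subtree $\delta$ and a word $z$, and it breaks the scheme if $i$ lies in an iteration layer that has not been disclosed and $z$ is accepted for $i$. *Claim.* If $S = \lambda + 2 + \log_2 \mathcal L_S$ with an integer $\lambda\ge 0$ (or, more generally, if $S \ge \lambda + 2 + \log_2\mathcal L_S$), then the full scheme is as secure as a $\lambda$-bit random oracle: for each such $\delta$, each $Q\ge 0$ and each such $\mathcal A$, $$\Pr[\mathcal A\text{ breaks the scheme}] \;\le\; \frac{\mathcal L_S\,(2Q+2P+1)}{2^S} \;\le\; \frac{2Q+2P+1}{2^{\lambda+2}},$$ and there is an algorithm $\mathcal B$ making at most $\max(Q,P)$ queries to a uniformly random function $f:\{0,1\}^\lambda\to\{0,1\}^\lambda$ which, given $f(x)$ for a uniformly random $x$,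 finds a preimage of $f(x)$ under $f$ with probability at least $\Pr[\mathcal A\text{ breaks the scheme}]$. -/

import Mathlib

/-- The probability of the event `E` under the uniform distribution on the finite space `Ω`. -/
noncomputable def uniformProb {Ω : Type*} [Fintype Ω] (E : Ω → Prop) : ℝ := by
  classical
  exact ((Finset.univ.filter E).card : ℝ) / (Fintype.card Ω : ℝ)

/-- Bit strings of length `S`. -/
abbrev Word (S : ℕ) : Type := Fin S → Bool

namespace SmartOTP

/-! ### The scheme

`N` is the number of OTPs of the parent tree, `NS` the number of OTPs of a subtree and `P` the
length of a hash chain, so that the parent tree has `N / P` chains and a subtree has `NS / P`.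
The hash function is a random oracle with domain separation: `h m x` is the hash of the word `x`
under the domain tag of the `m`-th step of a chain.  All chains share these `P` functions.
The first items of the chains are the values of the keyed function `F`. -/

/-- The step of a hash chain from position `m` to position `m + 1` (there are `P` steps). -/
def step {P S : ℕ} (h : Fin P → Word S → Word S) (m : ℕ) (x : Word S) : Word S :=
  if hm : m < P then h ⟨m, hm⟩ x else x

/-- `n` consecutive steps of a hash chain, the first of them leaving position `m`. -/
def chain {P S : ℕ} (h : Fin P → Word S → Word S) (m : ℕ) : ℕ → Word S → Word S
  | 0, x => x
  | n + 1, x => step h (m + n) (chain h m n x)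

/-- The first item of the chain with index `c`. -/
def head {K S : ℕ} (F : Fin K → Word S) (c : ℕ) : Word S :=
  if hc : c < K then F ⟨c, hc⟩ else fun _ => false

/-- The position in its chain of the OTP of operation `i`. -/
def alpha (NS P i : ℕ) : ℕ := P - (i % NS) * P / NS - 1

/-- The index of the chain that holds the OTP of operation `i`. -/
def beta (NS P i : ℕ) : ℕ := i / NS * (NS / P) + i % (NS / P)

/-- The OTP of operation `i`. -/
def getOTP {K S : ℕ} (NS P : ℕ) (h : Fin P → Word S → Word S) (F : Fin K → Word S)
    (i : ℕ) : Word S :=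
  chain h 0 (alpha NS P i) (head F (beta NS P i))

/-- The hashed end of the chain with index `c`; these are the leaves of the Merkle tree. -/
def leaf {P K S : ℕ} (h : Fin P → Word S → Word S) (F : Fin K → Word S) (c : ℕ) : Word S :=
  chain h 0 P (head F c)

/-- The check of a password `z` offered for operation `i`: hashing it along the remaining part of
the chain of `i` has to give the leaf of that chain. -/
def Accepts {K S : ℕ} (NS P : ℕ) (h : Fin P → Word S → Word S) (F : Fin K → Word S)
    (i : ℕ) (z : Word S) : Prop :=
  chain h (alpha NS P i) (P - alpha NS P i) z = leaf h F (beta NS P i)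

/-! ### The attack on the OTPs -/

/-- An adaptive adversary with access to the random oracle, attacking a subtree of `L` chains.
At any moment it may query the oracle (`hash`), wait until the user has used up (and so
disclosed) the next iteration layer of the subtree (`nextLayer`), or stop and offer the password
`z` for operation `i` (`forge`). -/
inductive Attacker (P S L : ℕ) : Type
  | forge (i : ℕ) (z : Word S) : Attacker P S L
  | hash (m : Fin P) (x : Word S) (k : Word S → Attacker P S L) : Attacker P S L
  | nextLayer (k : (Fin L → Word S) → Attacker P S L) : Attacker P S L

/-- The adversary makes at most `Q` oracle queries, whatever the answers are. -/
def Attacker.AtMost {P S L : ℕ} : Attacker P S L → ℕ → Prop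
  | .forge _ _, _ => True
  | .hash _ _ _, 0 => False
  | .hash _ _ k, Q + 1 => ∀ y, (k y).AtMost Q
  | .nextLayer k, Q => ∀ v, (k v).AtMost Q

/-- The adversary, run against subtree `δ` after `t` of its iteration layers have been disclosed,
succeeds: the password that it finally offers is accepted for an operation of the subtree that
lies in an iteration layer not disclosed so far. -/
def Attacker.Succeeds {K P S : ℕ} (NS δ : ℕ) (h : Fin P → Word S → Word S)
    (F : Fin K → Word S) : Attacker P S (NS / P) → ℕ → Prop
  | .forge i z, t =>
      δ * NS + t * (NS / P) ≤ i ∧ i < (δ + 1) * NS ∧ Accepts NS P h F i z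
  | .hash m x k, t => (k (h m x)).Succeeds NS δ h F t
  | .nextLayer k, t =>
      (k fun j => getOTP NS P h F (δ * NS + t * (NS / P) + (j : ℕ))).Succeeds NS δ h F (t + 1)

/-- An adversary strategy against subtree `δ`.  Besides its random coins, it is given the leaves of
the subtree, which are visible once the subtree is introduced, and the first items of all chains of
the earlier subtrees, which have been disclosed when those were depleted (every OTP of the earlier
subtrees is obtained from them by hashing). -/
abbrev Strategy (C : Type*) (NS P S δ : ℕ) : Type _ :=
  C → (Fin (NS / P) → Word S) → (Fin (δ * (NS / P)) → Word S) → Attacker P S (NS / P)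

/-- The probability, over the coins, the random oracle and the first items of the chains, that the
adversary breaks the scheme while subtree `δ` is in use. -/
noncomputable def breakProb {C : Type*} [Fintype C] (N NS P S δ : ℕ)
    (A : Strategy C NS P S δ) : ℝ :=
  uniformProb fun ω : C × (Fin P → Word S → Word S) × (Fin (N / P) → Word S) =>
    (A ω.1 (fun j => leaf ω.2.1 ω.2.2 (δ * (NS / P) + (j : ℕ)))
      (fun j => head ω.2.2 (j : ℕ))).Succeeds NS δ ω.2.1 ω.2.2 0

end SmartOTP

/-! ### Inversion of a `b`-bit random oracle -/

namespace RandomOracle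

/-- An adaptive algorithm with access to an oracle on `b`-bit words, which outputs a word. -/
inductive Inverter (b : ℕ) : Type
  | output (x : Word b) : Inverter b
  | query (x : Word b) (k : Word b → Inverter b) : Inverter b

/-- The algorithm makes at most `q` oracle queries, whatever the answers are. -/
def Inverter.AtMost {b : ℕ} : Inverter b → ℕ → Prop
  | .output _, _ => True
  | .query _ _, 0 => False
  | .query _ k, q + 1 => ∀ y, (k y).AtMost q

/-- The output of the algorithm with oracle `f`. -/
def Inverter.run {b : ℕ} (f : Word b → Word b) : Inverter b → Word b
  | .output x => x
  | .query x k => (k (f x)).run f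

/-- The probability, over a random function `f` and a random point `x`, that the algorithm finds a
preimage of the given image `f x`. -/
noncomputable def inversionProb {b : ℕ} (B : Word b → Inverter b) : ℝ :=
  uniformProb fun ω : (Word b → Word b) × Word b =>
    ω.1 ((B (ω.1 ω.2)).run ω.1) = ω.1 ω.2

end RandomOracle

/-! Fix the coins and the first items of all chains outside the subtree. What remains random is the
oracle `g` and the `L = NS / P` starting words `x`. Only the values of `g` on the chain items matter
for the chains, so `g` may be replaced elsewhere by an independent oracle `h`
(`uniformProb_splice`). After `t` layers the positions from `P - t` on are known.

Let a winning attacker finally hash its password to the end of the chain. Either it offers or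
queries an undisclosed item, or some query outside the chains is answered by a chain item
(`Attacker.Wins.guesses_or_hits`).

Guess: as long as no guess has succeeded, queries at undisclosed positions are answered by `h`
alone. Renaming the words at one position preserves the law of the model, so given the disclosed
items every earlier item is uniform. Each of `Q + 1` attempts costs at most `L / 2 ^ S`
(`uniformProb_guesses_le`).

Hit: with the chains fixed, a fresh query off the chains has a uniform answer under `h`. Each of `Q
+ P` queries costs at most `L / 2 ^ S` (`uniformProb_hits_le`).

The sum `(2Q + P + 1) L / 2 ^ S` is at most `(max Q P + 1) / 2 ^ lam`, and exhaustive search with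
`max Q P` queries and one final guess achieves the minimum of this and 1 (`exists_inverter`). -/

/-! ### Uniform probabilities -/

section UniformProb

open scoped Classical in
theorem uniformProb_eq_sum {Ω : Type*} [Fintype Ω] (E : Ω → Prop) :
    uniformProb E = (∑ ω, if E ω then (1 : ℝ) else 0) / Fintype.card Ω := by
  simp [uniformProb]

theorem uniformProb_nonneg {Ω : Type*} [Fintype Ω] (E : Ω → Prop) : 0 ≤ uniformProb E := by
  unfold uniformProb; positivity

theorem uniformProb_mono {Ω : Type*} [Fintype Ω] {E F : Ω → Prop} (h : ∀ ω, E ω → F ω) :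
    uniformProb E ≤ uniformProb F := by
  classical
  unfold uniformProb
  gcongr
  exact h _

theorem uniformProb_le_one {Ω : Type*} [Fintype Ω] (E : Ω → Prop) : uniformProb E ≤ 1 := by
  classical
  unfold uniformProb
  exact div_le_one_of_le₀ (by exact_mod_cast Finset.card_le_univ _) (by positivity)

theorem uniformProb_congr {Ω : Type*} [Fintype Ω] {E F : Ω → Prop} (h : ∀ ω, E ω ↔ F ω) :
    uniformProb E = uniformProb F :=
  congrArg uniformProb (funext fun ω => propext (h ω))

theorem uniformProb_false {Ω : Type*} [Fintype Ω] {E : Ω → Prop} (h : ∀ ω, ¬ E ω) :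
    uniformProb E = 0 := by
  simp [uniformProb_eq_sum, h]

theorem uniformProb_or_le {Ω : Type*} [Fintype Ω] (E F : Ω → Prop) :
    uniformProb (fun ω => E ω ∨ F ω) ≤ uniformProb E + uniformProb F := by
  classical
  simp only [uniformProb_eq_sum, ← add_div, ← Finset.sum_add_distrib]
  gcongr with ω
  by_cases h : E ω <;> by_cases h' : F ω <;> simp [h, h']

theorem uniformProb_comp_equiv {Ω Ω' : Type*} [Fintype Ω] [Fintype Ω'] (e : Ω ≃ Ω')
    (E : Ω' → Prop) : uniformProb (fun ω => E (e ω)) = uniformProb E := by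
  classical
  rw [uniformProb_eq_sum, uniformProb_eq_sum, Fintype.card_congr e,
    Equiv.sum_comp e fun ω => if E ω then (1 : ℝ) else 0]

theorem uniformProb_eq_sum_fiber {Ω β : Type*} [Fintype Ω] [Fintype β] (f : Ω → β)
    (E : Ω → Prop) : uniformProb E = ∑ b, uniformProb fun ω => f ω = b ∧ E ω := by
  classical
  simp only [uniformProb_eq_sum, ← Finset.sum_div]
  rw [Finset.sum_comm]
  congr 1
  refine Finset.sum_congr rfl fun ω _ => ?_
  by_cases h : E ω <;> simp [h]

theorem uniformProb_exists_le {Ω β : Type*} [Fintype Ω] [Fintype β] (E : β → Ω → Prop) :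
    uniformProb (fun ω => ∃ b, E b ω) ≤ ∑ b, uniformProb (E b) := by
  classical
  simp only [uniformProb_eq_sum, ← Finset.sum_div]
  rw [Finset.sum_comm]
  gcongr with ω
  split_ifs with h
  · obtain ⟨b, hb⟩ := h
    calc (1 : ℝ) = if E b ω then 1 else 0 := by simp [hb]
      _ ≤ _ := Finset.single_le_sum (f := fun b => if E b ω then (1 : ℝ) else 0)
        (fun _ _ => by positivity) (Finset.mem_univ b)
  · positivity

theorem uniformProb_prod_le {α β : Type*} [Fintype α] [Fintype β] (E : α × β → Prop) {ε : ℝ}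
    (hε : 0 ≤ ε) (h : ∀ a, uniformProb (fun b => E (a, b)) ≤ ε) : uniformProb E ≤ ε := by
  classical
  rcases isEmpty_or_nonempty α with hα | hα
  · rwa [uniformProb_false fun ω => (hα.false ω.1).elim]
  have key : uniformProb E = (∑ a, uniformProb fun b => E (a, b)) / Fintype.card α := by
    simp only [uniformProb_eq_sum, Fintype.sum_prod_type, Fintype.card_prod, ← Finset.sum_div,
      div_div, Nat.cast_mul]
    rw [mul_comm]
  rw [key, div_le_iff₀ (by exact_mod_cast Fintype.card_pos)]
  calc _ ≤ ∑ _a : α, ε := Finset.sum_le_sum fun a _ => h a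
    _ = _ := by simp [mul_comm]

theorem uniformProb_prod_le' {α β : Type*} [Fintype α] [Fintype β] (E : α × β → Prop) {ε : ℝ}
    (hε : 0 ≤ ε) (h : ∀ b, uniformProb (fun a => E (a, b)) ≤ ε) : uniformProb E ≤ ε := by
  rw [← uniformProb_comp_equiv (Equiv.prodComm β α) E]
  exact uniformProb_prod_le _ hε h

theorem uniformProb_snd {α β : Type*} [Fintype α] [Fintype β] [Nonempty α] (E : β → Prop) :
    uniformProb (fun ω : α × β => E ω.2) = uniformProb E := by
  classical
  have hα : (Fintype.card α : ℝ) ≠ 0 := by exact_mod_cast Fintype.card_ne_zero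
  simp only [uniformProb_eq_sum, Fintype.sum_prod_type, Fintype.card_prod, Nat.cast_mul]
  trans (∑ _a : α, ∑ b, if E b then (1 : ℝ) else 0) / (Fintype.card α * Fintype.card β)
  · rfl
  rw [Finset.sum_const, Finset.card_univ, nsmul_eq_mul, mul_div_mul_left _ _ hα]

/-- A random variable whose law, restricted to an event, is invariant under all permutations of its
values is uniform on that event. -/
theorem uniformProb_and_eq_of_symm {Ω β : Type*} [Fintype Ω] [Fintype β]
    (E : Ω → Prop) (f : Ω → β) (e : Equiv.Perm β → Ω ≃ Ω) (hE : ∀ σ ω, E (e σ ω) ↔ E ω)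
    (hf : ∀ σ ω, f (e σ ω) = σ (f ω)) (b : β) :
    uniformProb (fun ω => f ω = b ∧ E ω) = uniformProb E / Fintype.card β := by
  classical
  have hsymm : ∀ b', uniformProb (fun ω => f ω = b' ∧ E ω) =
      uniformProb (fun ω => f ω = b ∧ E ω) := fun b' => by
    rw [← uniformProb_comp_equiv (e (Equiv.swap b b'))]
    refine uniformProb_congr fun ω => ?_
    rw [hE, hf, Equiv.swap_apply_eq_iff, Equiv.swap_apply_right]
  have hb : (Fintype.card β : ℝ) ≠ 0 := by
    exact_mod_cast (Fintype.card_pos_iff.2 ⟨b⟩).ne'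
  rw [uniformProb_eq_sum_fiber f E, Finset.sum_congr rfl fun b' _ => hsymm b']
  simp [hb]

end UniformProb

/-! ### Inversion by exhaustive search -/

namespace RandomOracle

/-- The inverter that queries the words of a list and, failing all of them, guesses `d`. -/
def scan {b : ℕ} (d : Word b) : List (Word b) → Word b → Inverter b
  | [], _ => .output d
  | w :: l, y => .query w fun v => if v = y then .output w else scan d l y

theorem scan_atMost {b : ℕ} (d : Word b) (l : List (Word b)) (y : Word b) {q : ℕ}
    (hq : l.length ≤ q) : (scan d l y).AtMost q := by
  induction l generalizing q with
  | nil => cases q <;> trivial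
  | cons w l ih =>
    obtain ⟨q, rfl⟩ : ∃ q', q = q' + 1 := ⟨q - 1, by simp at hq; omega⟩
    intro v
    simp only [List.length_cons, Nat.add_le_add_iff_right] at hq
    dsimp only
    split_ifs
    · cases q <;> trivial
    · exact ih hq

/-- A scan that stops early has found some preimage, perhaps not `x`; a scan that exhausts the list
has excluded all of `l`, so `x = d`. -/
theorem scan_run {b : ℕ} (f : Word b → Word b) (d : Word b) (l : List (Word b)) (x : Word b)
    (hx : x ∈ d :: l) : f ((scan d l (f x)).run f) = f x := by
  induction l with
  | nil =>
    obtain rfl : x = d := by simpa using hx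
    rfl
  | cons w l ih =>
    simp only [scan, Inverter.run]
    split_ifs with h
    · exact h
    · refine ih ?_
      simp only [List.mem_cons] at hx ⊢
      rcases hx with hx | rfl | hx
      · exact Or.inl hx
      · exact absurd rfl h
      · exact Or.inr hx

/-- With `q` queries a random function on `b`-bit words is inverted with probability at least
`(q + 1) / 2 ^ b`, or `1` if this is larger. -/
theorem exists_inverter (b q : ℕ) : ∃ B : Word b → Inverter b, (∀ y, (B y).AtMost q) ∧
    min 1 (((q : ℝ) + 1) / 2 ^ b) ≤ inversionProb B := by
  classical
  -- There are `q + 1` candidates for `q` queries because the last one is output unqueried.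
  obtain ⟨T, hT⟩ : ∃ T : Finset (Word b), T.card = min (q + 1) (2 ^ b) := by
    obtain ⟨T, -, hT⟩ := Finset.exists_subset_card_eq (s := (Finset.univ : Finset (Word b)))
      (n := min (q + 1) (2 ^ b)) (by simp)
    exact ⟨T, hT⟩
  have hTl : T.toList.length = min (q + 1) (2 ^ b) := by simp [hT]
  obtain ⟨d, l, hdl⟩ : ∃ d l, T.toList = d :: l :=
    List.exists_cons_of_length_pos (by rw [hTl]; positivity)
  have hl : l.length ≤ q := by
    rw [hdl, List.length_cons] at hTl
    omega
  refine ⟨scan d l, fun y => scan_atMost d l y hl, ?_⟩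
  have h1 : uniformProb (fun x : Word b => x ∈ T) = min 1 (((q : ℝ) + 1) / 2 ^ b) := by
    have hf : ∀ _ : DecidablePred (· ∈ T), Finset.univ.filter (· ∈ T) = T := by
      intro _
      ext
      simp
    rw [uniformProb, hf, hT]
    push_cast
    simp only [Fintype.card_pi, Fintype.card_bool, Finset.prod_const, Finset.card_univ,
      Fintype.card_fin]
    push_cast
    rw [← min_div_div_right (by positivity), div_self (by positivity), min_comm]
  rw [← h1, ← uniformProb_snd (α := Word b → Word b)]
  refine uniformProb_mono fun ω hω => scan_run ω.1 d l ω.2 ?_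
  rw [← hdl]
  simpa using hω

end RandomOracle

namespace SmartOTP

variable {P S L : ℕ}

/-! ### Hash chains -/

theorem step_of_lt (h : Fin P → Word S → Word S) {m : ℕ} (hm : m < P) (x : Word S) :
    step h m x = h ⟨m, hm⟩ x := dif_pos hm

theorem chain_succ' (h : Fin P → Word S → Word S) (m n : ℕ) (x : Word S) :
    chain h m (n + 1) x = chain h (m + 1) n (step h m x) := by
  induction n with
  | zero => rfl
  | succ n ih =>
    rw [chain, ih, chain]
    congr 1
    omega

/-- The items at position `m` of the chains that start at the words `x j`. -/
def items (h : Fin P → Word S → Word S) (x : Fin L → Word S) (m : ℕ) (j : Fin L) : Word S :=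
  chain h 0 m (x j)

theorem items_succ (h : Fin P → Word S → Word S) (x : Fin L → Word S) (m : Fin P) (j : Fin L) :
    items h x (m + 1) j = h m (items h x m j) := by
  simp [items, chain, step]

/-- The words occurring at position `m` of one of the chains. -/
def honest (h : Fin P → Word S → Word S) (x : Fin L → Word S) (m : ℕ) : Set (Word S) :=
  Set.range (items h x m)

/-! ### Resampling the oracle away from the chains -/

open scoped Classical in
/-- The oracle that agrees with `g` on the items of the chains and with `h` elsewhere. -/
noncomputable def splice (g h : Fin P → Word S → Word S) (x : Fin L → Word S) :
    Fin P → Word S → Word S :=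
  fun m w => if w ∈ honest g x m then g m w else h m w

/-- The chains evaluate `g` only at their own items, where the spliced oracle still equals `g`. -/
theorem items_splice (g h : Fin P → Word S → Word S) (x : Fin L → Word S) :
    items (splice g h x) x = items g x := by
  funext m
  induction m with
  | zero => rfl
  | succ m ih =>
    funext j
    by_cases hm : m < P
    · rw [items_succ _ _ ⟨m, hm⟩, items_succ _ _ ⟨m, hm⟩, ih]
      exact if_pos ⟨j, rfl⟩
    · have hlast : ∀ k : Fin P → Word S → Word S, items k x (m + 1) j = items k x m j := fun k => by
        simp [items, chain, step, hm]
      rw [hlast, hlast, ih]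

theorem honest_splice (g h : Fin P → Word S → Word S) (x : Fin L → Word S) (m : ℕ) :
    honest (splice g h x) x m = honest g x m := by
  rw [honest, items_splice, honest]

open scoped Classical in
/-- Exchanging two oracles away from the chains of the first one. -/
noncomputable def exchange (ω : (Fin P → Word S → Word S) × (Fin P → Word S → Word S) ×
    (Fin L → Word S)) :
    (Fin P → Word S → Word S) × (Fin P → Word S → Word S) × (Fin L → Word S) :=
  (fun m w => if w ∈ honest ω.2.1 ω.2.2 m then ω.1 m w else ω.2.1 m w,
    splice ω.2.1 ω.1 ω.2.2, ω.2.2)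

/-- The exchange leaves the chains intact, so the second exchange takes place on the same set of
points as the first. -/
theorem exchange_involutive : Function.Involutive (exchange (P := P) (S := S) (L := L)) := by
  rintro ⟨h, g, x⟩
  refine Prod.ext (funext fun m => funext fun w => ?_)
    (Prod.ext (funext fun m => funext fun w => ?_) rfl)
  all_goals
    have heq : w ∈ honest (splice g h x) x m ↔ w ∈ honest g x m := by
      rw [honest_splice g h x m]
    by_cases hw : w ∈ honest g x m
  · exact (if_pos (heq.2 hw)).trans (if_pos hw)
  · exact (if_neg (mt heq.1 hw)).trans (if_neg hw)
  · exact (if_pos (heq.2 hw)).trans (if_pos hw)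
  · exact (if_neg (mt heq.1 hw)).trans (if_neg hw)

/-- A random oracle may be resampled away from the chains. -/
theorem uniformProb_splice (E : (Fin P → Word S → Word S) × (Fin L → Word S) → Prop) :
    uniformProb E = uniformProb fun ω : (Fin P → Word S → Word S) ×
      (Fin P → Word S → Word S) × (Fin L → Word S) => E (splice ω.2.1 ω.1 ω.2.2, ω.2.2) := by
  rw [← uniformProb_snd (α := Fin P → Word S → Word S),
    ← uniformProb_comp_equiv exchange_involutive.toPerm]
  rfl

/-! ### Relabelling the words -/

/-- The oracle after the words at every position `m` are renamed by `π m`. -/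
def relabel (π : ℕ → Equiv.Perm (Word S)) (g : Fin P → Word S → Word S) :
    Fin P → Word S → Word S :=
  fun m w => π (m + 1) (g m ((π m).symm w))

/-- The renamings cancel between consecutive steps. Beyond position `P` a step is the identity and
this fails. -/
theorem items_relabel (π : ℕ → Equiv.Perm (Word S)) (g : Fin P → Word S → Word S)
    (x : Fin L → Word S) {m : ℕ} (hm : m ≤ P) (j : Fin L) :
    items (relabel π g) (fun j => π 0 (x j)) m j = π m (items g x m j) := by
  induction m with
  | zero => rfl
  | succ m ih =>
    rw [items_succ _ _ ⟨m, hm⟩, items_succ _ _ ⟨m, hm⟩, ih (by omega)]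
    simp [relabel]

/-- Renaming the words at all positions is a bijection of the sample space. -/
def relabelEquiv (L : ℕ) (π : ℕ → Equiv.Perm (Word S)) :
    (Fin P → Word S → Word S) × (Fin L → Word S) ≃
      (Fin P → Word S → Word S) × (Fin L → Word S) where
  toFun ω := (relabel π ω.1, fun j => π 0 (ω.2 j))
  invFun ω := (relabel (fun m => (π m).symm) ω.1, fun j => (π 0).symm (ω.2 j))
  left_inv ω := by
    refine Prod.ext (funext fun m => funext fun w => ?_) (funext fun j => ?_) <;> simp [relabel]
  right_inv ω := by
    refine Prod.ext (funext fun m => funext fun w => ?_) (funext fun j => ?_) <;> simp [relabel]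

/-- Given the items at the positions from `n` on, every single item at an earlier position is
uniformly distributed. -/
theorem uniformProb_item_eq {n m : ℕ} (hmn : m < n) (hn : n ≤ P) (j : Fin L) (w : Word S)
    (D : ℕ → Fin L → Word S) :
    uniformProb (fun ω : (Fin P → Word S → Word S) × (Fin L → Word S) =>
      items ω.1 ω.2 m j = w ∧ ∀ a, n ≤ a → a ≤ P → items ω.1 ω.2 a = D a) =
    uniformProb (fun ω : (Fin P → Word S → Word S) × (Fin L → Word S) =>
      ∀ a, n ≤ a → a ≤ P → items ω.1 ω.2 a = D a) / 2 ^ S := by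
  -- Renaming at position `m` alone moves the items there by `σ` and fixes those at positions from
  -- `n` on.
  rw [uniformProb_and_eq_of_symm _ (fun ω => items ω.1 ω.2 m j)
    (fun σ => relabelEquiv L fun a => if a = m then σ else 1)]
  · simp
  · intro σ ω
    refine forall_congr' fun a => imp_congr_right fun ha => imp_congr_right fun haP => ?_
    have : items (relabelEquiv L (fun a => if a = m then σ else 1) ω).1
        (relabelEquiv L (fun a => if a = m then σ else 1) ω).2 a = items ω.1 ω.2 a := by
      funext j
      refine (items_relabel (fun a => if a = m then σ else 1) ω.1 ω.2 haP j).trans ?_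
      rw [if_neg (by omega)]
      rfl
    rw [this]
  · intro σ ω
    refine (items_relabel (fun a => if a = m then σ else 1) ω.1 ω.2
      (by omega : m ≤ P) j).trans ?_
    rw [if_pos rfl]

theorem uniformProb_mem_honest_le {n m : ℕ} (hmn : m < n) (hn : n ≤ P) (w : Word S)
    (D : ℕ → Fin L → Word S) :
    uniformProb (fun ω : (Fin P → Word S → Word S) × (Fin L → Word S) =>
      w ∈ honest ω.1 ω.2 m ∧ ∀ a, n ≤ a → a ≤ P → items ω.1 ω.2 a = D a) ≤
    L / 2 ^ S * uniformProb (fun ω : (Fin P → Word S → Word S) × (Fin L → Word S) =>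
      ∀ a, n ≤ a → a ≤ P → items ω.1 ω.2 a = D a) := by
  have h := uniformProb_exists_le fun (j : Fin L)
    (ω : (Fin P → Word S → Word S) × (Fin L → Word S)) =>
      items ω.1 ω.2 m j = w ∧ ∀ a, n ≤ a → a ≤ P → items ω.1 ω.2 a = D a
  simp only [uniformProb_item_eq hmn hn, Finset.sum_const, Finset.card_univ, Fintype.card_fin,
    nsmul_eq_mul] at h
  refine le_trans (uniformProb_mono ?_) (h.trans_eq (by ring))
  rintro ω ⟨⟨j, hj⟩, hD⟩
  exact ⟨j, hj, hD⟩

end SmartOTP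

namespace SmartOTP

variable {P S L : ℕ}

/-! ### The abstract attack -/

/-- The attacker offers a word, at the position `pos i < P - t` of a chain, which hashes to a leaf.
The items of the chains are `X`. -/
def Attacker.Wins (pos : ℕ → ℕ) (h : Fin P → Word S → Word S) (X : ℕ → Fin L → Word S) :
    Attacker P S L → ℕ → Prop
  | .forge i z, t => pos i < P - t ∧ chain h (pos i) (P - pos i) z ∈ Set.range (X P)
  | .hash m w k, t => (k (h m w)).Wins pos h X t
  | .nextLayer k, t => (k (X (P - 1 - t))).Wins pos h X (t + 1)

open scoped Classical in
/-- The attacker offers or queries an undisclosed item of a chain, in a run in which the items not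
yet disclosed are hashed by `h`. -/
noncomputable def Attacker.Guesses (pos : ℕ → ℕ) (h g : Fin P → Word S → Word S)
    (x : Fin L → Word S) : Attacker P S L → ℕ → Prop
  | .forge i z, t => pos i < P - t ∧ z ∈ honest g x (pos i)
  | .hash m w k, t => ((m : ℕ) < P - t ∧ w ∈ honest g x m) ∨
      (k (if P - t ≤ (m : ℕ) then splice g h x m w else h m w)).Guesses pos h g x t
  | .nextLayer k, t => (k (items g x (P - 1 - t))).Guesses pos h g x (t + 1)

/-- The attacker makes a query outside the chains which is answered by an item of a chain. -/
def Attacker.Hits (h : Fin P → Word S → Word S) (X : ℕ → Fin L → Word S) :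
    Attacker P S L → ℕ → Prop
  | .forge _ _, _ => False
  | .hash m w k, t => (w ∉ Set.range (X m) ∧ h m w ∈ Set.range (X (m + 1))) ∨
      (k (h m w)).Hits h X t
  | .nextLayer k, t => (k (X (P - 1 - t))).Hits h X (t + 1)

/-- Hashing `z` for `n` steps from position `a` on. -/
def Attacker.walk : ℕ → ℕ → Word S → Attacker P S L
  -- The final offer is a dummy: the walk is used only with `Attacker.Hits`, which is false at
  -- `forge`.
  | 0, a, z => .forge a z
  | n + 1, a, z => if ha : a < P then .hash ⟨a, ha⟩ z fun y => Attacker.walk n (a + 1) y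
      else .forge a z

/-- The attacker that, before it stops, hashes its password along the rest of the chain. -/
def Attacker.verified (pos : ℕ → ℕ) : Attacker P S L → Attacker P S L
  | .forge i z => Attacker.walk (P - pos i) (pos i) z
  | .hash m w k => .hash m w fun y => (k y).verified pos
  | .nextLayer k => .nextLayer fun v => (k v).verified pos

theorem Attacker.walk_atMost (n a : ℕ) (z : Word S) {q : ℕ} (hq : n ≤ q) :
    (Attacker.walk n a z : Attacker P S L).AtMost q := by
  induction n generalizing a z q with
  | zero => cases q <;> trivial
  | succ n ih =>
    obtain ⟨q, rfl⟩ : ∃ q', q = q' + 1 := ⟨q - 1, by omega⟩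
    rw [Attacker.walk]
    split_ifs
    · exact fun y => ih _ _ (by omega)
    · trivial

theorem Attacker.verified_atMost (pos : ℕ → ℕ) (A : Attacker P S L) {q : ℕ} (hA : A.AtMost q) :
    (A.verified pos).AtMost (q + P) := by
  induction A generalizing q with
  | forge i z => exact Attacker.walk_atMost _ _ _ (by omega)
  | hash m w k ih =>
    cases q with
    | zero => exact hA.elim
    | succ q =>
      rw [Nat.succ_add]
      exact fun y => ih y (hA y)
  | nextLayer k ih =>
    have hA' : ∀ v, (k v).AtMost q := by cases q <;> exact hA
    have : ∀ v, ((k v).verified pos).AtMost (q + P) := fun v => ih v (hA' v)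
    revert this
    generalize q + P = r
    cases r <;> exact id

/-- Without a hit the walk cannot enter the chains from outside; ending on them, it was on them from
the start. -/
theorem mem_of_chain_mem {h : Fin P → Word S → Word S} {X : ℕ → Fin L → Word S} {n a t : ℕ}
    {z : Word S} (ha : a + n ≤ P) (hz : chain h a n z ∈ Set.range (X (a + n)))
    (hH : ¬ (Attacker.walk n a z : Attacker P S L).Hits h X t) : z ∈ Set.range (X a) := by
  induction n generalizing a z with
  | zero => exact hz
  | succ n ih =>
    have haP : a < P := by omega
    rw [Attacker.walk, dif_pos haP, Attacker.Hits, not_or] at hH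
    rw [chain_succ', step_of_lt h haP] at hz
    have := ih (by omega) (by rwa [Nat.add_right_comm] ) hH.2
    by_contra hza
    exact hH.1 ⟨hza, this⟩

/-- Until the first guess, the real run and the run with undisclosed positions answered by `h`
coincide, since the spliced oracle differs from `h` only on the chains. -/
theorem Attacker.Wins.guesses_or_hits {pos : ℕ → ℕ} {h g : Fin P → Word S → Word S}
    {x : Fin L → Word S} {A : Attacker P S L} {t : ℕ}
    (hW : A.Wins pos (splice g h x) (items g x) t) :
    A.Guesses pos h g x t ∨ (A.verified pos).Hits (splice g h x) (items g x) t := by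
  induction A generalizing t with
  | forge i z =>
    refine or_iff_not_imp_right.2 fun hH => ⟨hW.1, ?_⟩
    have hi : pos i + (P - pos i) = P := by have := hW.1; omega
    exact mem_of_chain_mem hi.le (by rw [hi]; exact hW.2) hH
  | hash m w k ih =>
    rw [or_iff_not_imp_left]
    intro hG
    rw [Attacker.Guesses, not_or] at hG
    refine Or.inr ((ih _ hW).resolve_left ?_)
    by_cases hm : P - t ≤ (m : ℕ)
    · rw [if_pos hm] at hG
      exact hG.2
    · rw [if_neg hm] at hG
      rw [splice, if_neg fun hw => hG.1 ⟨by omega, hw⟩]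
      exact hG.2
  | nextLayer k ih => exact ih _ hW

/-! ### Guessing an undisclosed item -/

theorem Attacker.not_guesses (pos : ℕ → ℕ) (h g : Fin P → Word S → Word S) (x : Fin L → Word S)
    (A : Attacker P S L) {t : ℕ} (ht : P ≤ t) : ¬ A.Guesses pos h g x t := by
  induction A generalizing t with
  | forge i z => intro hG; have := hG.1; omega
  | hash m w k ih =>
    rintro (hG | hG)
    · omega
    · exact ih _ ht hG
  | nextLayer k ih => exact ih _ (by omega)

theorem forall_eq_update_iff {β : Type*} {n : ℕ} (hn : n ≤ P) (X D : ℕ → β) (v : β) :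
    (∀ a, n ≤ a → a ≤ P → X a = Function.update D n v a) ↔
      X n = v ∧ ∀ a, n + 1 ≤ a → a ≤ P → X a = D a := by
  constructor
  · intro H
    refine ⟨by simpa using H n le_rfl hn, fun a ha haP => ?_⟩
    rw [H a (by omega) haP, Function.update_of_ne (by omega)]
  · rintro ⟨hv, H⟩ a ha haP
    rcases ha.eq_or_lt with rfl | ha
    · simpa using hv
    · rw [H a ha haP, Function.update_of_ne (by omega)]

/-- With `h` fixed, the disclosed items `D` determine the next move, which allows induction on the
attacker. Joint instead of conditional probabilities avoid null events and add up over the values of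
a new layer. -/
theorem uniformProb_guesses_and_le (pos : ℕ → ℕ) (h : Fin P → Word S → Word S)
    (A : Attacker P S L) {q t : ℕ} (hA : A.AtMost q) (D : ℕ → Fin L → Word S) :
    uniformProb (fun ω : (Fin P → Word S → Word S) × (Fin L → Word S) =>
      A.Guesses pos h ω.1 ω.2 t ∧ ∀ a, P - t ≤ a → a ≤ P → items ω.1 ω.2 a = D a) ≤
    (q + 1) * (L / 2 ^ S) * uniformProb (fun ω : (Fin P → Word S → Word S) × (Fin L → Word S) =>
      ∀ a, P - t ≤ a → a ≤ P → items ω.1 ω.2 a = D a) := by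
  classical
  induction A generalizing q t D with
  | forge i z =>
    by_cases hi : pos i < P - t
    · refine (uniformProb_mono fun ω hω => ⟨hω.1.2, hω.2⟩).trans
        ((uniformProb_mem_honest_le hi (by omega) z D).trans ?_)
      refine mul_le_mul_of_nonneg_right ?_ (uniformProb_nonneg _)
      exact le_mul_of_one_le_left (by positivity) (by norm_cast; omega)
    · rw [uniformProb_false fun ω hω => hi hω.1.1]
      exact mul_nonneg (by positivity) (uniformProb_nonneg _)
  | hash m w k ih =>
    cases q with
    | zero => exact hA.elim
    | succ q =>
      have hfirst : uniformProb (fun ω : (Fin P → Word S → Word S) × (Fin L → Word S) =>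
          ((m : ℕ) < P - t ∧ w ∈ honest ω.1 ω.2 m) ∧
            ∀ a, P - t ≤ a → a ≤ P → items ω.1 ω.2 a = D a) ≤
          L / 2 ^ S * uniformProb (fun ω : (Fin P → Word S → Word S) × (Fin L → Word S) =>
            ∀ a, P - t ≤ a → a ≤ P → items ω.1 ω.2 a = D a) := by
        by_cases hm : (m : ℕ) < P - t
        · exact (uniformProb_mono fun ω hω => ⟨hω.1.2, hω.2⟩).trans
            (uniformProb_mem_honest_le hm (by omega) w D)
        · rw [uniformProb_false fun ω hω => hm hω.1.1]
          exact mul_nonneg (by positivity) (uniformProb_nonneg _)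
      -- The answer is a function of `D`: at a disclosed position `m` both the items at `m` and
      -- their images at `m + 1` are known, and all else is answered by `h`.
      obtain ⟨y, hy⟩ : ∃ y, ∀ ω : (Fin P → Word S → Word S) × (Fin L → Word S),
          (∀ a, P - t ≤ a → a ≤ P → items ω.1 ω.2 a = D a) →
          (if P - t ≤ (m : ℕ) then splice ω.1 h ω.2 m w else h m w) = y := by
        by_cases hm : P - t ≤ (m : ℕ)
        · by_cases hw : ∃ j, D m j = w
          · obtain ⟨j, hj⟩ := hw
            refine ⟨D (m + 1) j, fun ω hω => ?_⟩
            have hwj : items ω.1 ω.2 m j = w := by rw [hω m hm m.2.le, hj]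
            rw [if_pos hm, splice, if_pos ⟨j, hwj⟩, ← hω (m + 1) (by omega) m.2, items_succ, hwj]
          · refine ⟨h m w, fun ω hω => ?_⟩
            rw [if_pos hm, splice, if_neg]
            rintro ⟨j, hj⟩
            exact hw ⟨j, by rw [← hω m hm m.2.le, hj]⟩
        · exact ⟨h m w, fun ω _ => if_neg hm⟩
      refine (uniformProb_mono fun ω hω => ?_).trans ((uniformProb_or_le _ _).trans
        ((add_le_add hfirst (ih y (hA y) (t := t) D)).trans_eq ?_))
      · rcases hω.1 with hG | hG
        · exact Or.inl ⟨hG, hω.2⟩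
        · exact Or.inr ⟨by rwa [hy ω hω.2] at hG, hω.2⟩
      · push_cast
        ring
  | nextLayer k ih =>
    have hA' : ∀ v, (k v).AtMost q := by cases q <;> exact hA
    -- Here `P - 1 - t` truncates to `0` and no new position is disclosed; but nothing is left to
    -- guess either.
    by_cases ht : P ≤ t
    · rw [uniformProb_false fun ω hω => Attacker.not_guesses _ _ _ _ _ ht hω.1]
      exact mul_nonneg (by positivity) (uniformProb_nonneg _)
    have hn : P - (t + 1) = P - 1 - t := by omega
    have hn' : P - t = P - 1 - t + 1 := by omega
    -- Split by the value `v` of the new layer, which then extends `D` at position `P - 1 - t`.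
    rw [uniformProb_eq_sum_fiber (fun ω => items ω.1 ω.2 (P - 1 - t)),
      uniformProb_eq_sum_fiber
        (fun ω : (Fin P → Word S → Word S) × (Fin L → Word S) => items ω.1 ω.2 (P - 1 - t)) fun ω =>
        ∀ a, P - t ≤ a → a ≤ P → items ω.1 ω.2 a = D a, Finset.mul_sum]
    refine Finset.sum_le_sum fun v _ => ?_
    have := ih v (hA' v) (t := t + 1) (Function.update D (P - 1 - t) v)
    simp only [hn, forall_eq_update_iff (by omega : P - 1 - t ≤ P)] at this
    rw [hn']
    refine le_trans (uniformProb_mono ?_) this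
    rintro ω ⟨hv, hG, hD⟩
    refine ⟨?_, hv, hD⟩
    rwa [Attacker.Guesses, hv] at hG

theorem uniformProb_guesses_le (pos : ℕ → ℕ) (h : Fin P → Word S → Word S)
    (A : (Fin L → Word S) → Attacker P S L) {q : ℕ} (hA : ∀ v, (A v).AtMost q) :
    uniformProb (fun ω : (Fin P → Word S → Word S) × (Fin L → Word S) =>
      (A (items ω.1 ω.2 P)).Guesses pos h ω.1 ω.2 0) ≤ (q + 1) * (L / 2 ^ S) := by
  classical
  have hP : ∀ (X : ℕ → Fin L → Word S) (v : Fin L → Word S),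
      (∀ a, P - 0 ≤ a → a ≤ P → X a = v) ↔ X P = v := fun X v =>
    ⟨fun H => H P (by omega) le_rfl, fun H a ha haP => by
      rw [← H]; congr 1; omega⟩
  calc _ = ∑ v, uniformProb fun ω : (Fin P → Word S → Word S) × (Fin L → Word S) =>
        items ω.1 ω.2 P = v ∧ (A (items ω.1 ω.2 P)).Guesses pos h ω.1 ω.2 0 :=
        uniformProb_eq_sum_fiber _ _
    _ ≤ ∑ v, (q + 1) * (L / 2 ^ S) *
        uniformProb fun ω : (Fin P → Word S → Word S) × (Fin L → Word S) =>
          items ω.1 ω.2 P = v ∧ True := by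
      refine Finset.sum_le_sum fun v _ => ?_
      have := uniformProb_guesses_and_le pos h (A v) (t := 0) (hA v) fun _ => v
      simp only [hP] at this
      simp only [and_true]
      refine le_trans (uniformProb_mono ?_) this
      rintro ω ⟨hv, hG⟩
      exact ⟨by rwa [hv] at hG, hv⟩
    _ = (q + 1) * (L / 2 ^ S) *
        uniformProb fun _ : (Fin P → Word S → Word S) × (Fin L → Word S) => True := by
      rw [← Finset.mul_sum, ← uniformProb_eq_sum_fiber]
    _ ≤ _ := mul_le_of_le_one_right (by positivity) (uniformProb_le_one _)

/-! ### Hitting an item from outside the chains -/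

/-- The values of a random oracle at different points are independent and uniform. -/
theorem uniformProb_apply_eq {R : Set (Fin P × Word S)} {m : Fin P} {w : Word S}
    (hR : (m, w) ∉ R) (h₀ : Fin P → Word S → Word S) (y : Word S) :
    uniformProb (fun h : Fin P → Word S → Word S =>
      h m w = y ∧ ∀ p ∈ R, h p.1 p.2 = h₀ p.1 p.2) =
    uniformProb (fun h : Fin P → Word S → Word S => ∀ p ∈ R, h p.1 p.2 = h₀ p.1 p.2) /
      2 ^ S := by
  let e : Equiv.Perm (Word S) → (Fin P → Word S → Word S) ≃ (Fin P → Word S → Word S) :=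
    fun σ => Equiv.piCongrRight fun m' => Equiv.piCongrRight fun w' =>
      if (m', w') = (m, w) then σ else Equiv.refl _
  have he : ∀ σ h m' w', e σ h m' w' = (if (m', w') = (m, w) then σ else Equiv.refl _) (h m' w') :=
    fun _ _ _ _ => rfl
  rw [uniformProb_and_eq_of_symm _ (fun h => h m w) e]
  · simp
  · intro σ h
    refine forall_congr' fun p => imp_congr_right fun hp => ?_
    rw [he, if_neg fun hpm : p = (m, w) => hR (hpm ▸ hp)]
    rfl
  · intro σ h
    rw [he, if_pos rfl]

/-- Lazy sampling with fixed chains: `R` collects the points already sampled, `h₀` their values, and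
`hR` says that none of them was a hit. Queries on a chain or in `R` cannot hit; a fresh one hits
with probability at most `L / 2 ^ S`. -/
theorem uniformProb_hits_and_le (g : Fin P → Word S → Word S) (x : Fin L → Word S)
    (A : Attacker P S L) {q t : ℕ} (hA : A.AtMost q) (R : Set (Fin P × Word S))
    (h₀ : Fin P → Word S → Word S)
    (hR : ∀ p ∈ R, p.2 ∉ honest g x p.1 → h₀ p.1 p.2 ∉ honest g x (p.1 + 1)) :
    uniformProb (fun h : Fin P → Word S → Word S =>
      A.Hits (splice g h x) (items g x) t ∧ ∀ p ∈ R, h p.1 p.2 = h₀ p.1 p.2) ≤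
    q * (L / 2 ^ S) * uniformProb (fun h : Fin P → Word S → Word S =>
      ∀ p ∈ R, h p.1 p.2 = h₀ p.1 p.2) := by
  classical
  induction A generalizing q t R h₀ with
  | forge i z =>
    rw [uniformProb_false fun ω hω => hω.1]
    exact mul_nonneg (by positivity) (uniformProb_nonneg _)
  | nextLayer k ih =>
    have hA' : ∀ v, (k v).AtMost q := by cases q <;> exact hA
    exact ih _ (hA' _) R h₀ hR
  | hash m w k ih =>
    cases q with
    | zero => exact hA.elim
    | succ q =>
      have hmono : (q : ℝ) * (L / 2 ^ S) *
            uniformProb (fun h : Fin P → Word S → Word S => ∀ p ∈ R, h p.1 p.2 = h₀ p.1 p.2) ≤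
          (q + 1 : ℕ) * (L / 2 ^ S) *
            uniformProb (fun h : Fin P → Word S → Word S => ∀ p ∈ R, h p.1 p.2 = h₀ p.1 p.2) := by
        refine mul_le_mul_of_nonneg_right ?_ (uniformProb_nonneg _)
        push_cast
        gcongr
        linarith
      by_cases hw : w ∈ honest g x m
      · refine le_trans (uniformProb_mono ?_) ((ih (g m w) (t := t) (hA _) R h₀ hR).trans hmono)
        rintro h ⟨hH | hH, hh⟩
        · exact absurd hw hH.1
        · exact ⟨by rwa [splice, if_pos hw] at hH, hh⟩
      by_cases hmw : (m, w) ∈ R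
      · refine le_trans (uniformProb_mono ?_) ((ih (h₀ m w) (t := t) (hA _) R h₀ hR).trans hmono)
        rintro h ⟨hH, hh⟩
        rw [Attacker.Hits, splice, if_neg hw, hh _ hmw] at hH
        exact ⟨hH.resolve_left fun hH => hR _ hmw hw hH.2, hh⟩
      have hfirst : uniformProb (fun h : Fin P → Word S → Word S =>
            ∃ j, h m w = items g x (m + 1) j ∧ ∀ p ∈ R, h p.1 p.2 = h₀ p.1 p.2) ≤
          L / 2 ^ S * uniformProb (fun h : Fin P → Word S → Word S =>
            ∀ p ∈ R, h p.1 p.2 = h₀ p.1 p.2) := by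
        refine (uniformProb_exists_le _).trans_eq ?_
        simp only [uniformProb_apply_eq hmw, Finset.sum_const, Finset.card_univ,
          Fintype.card_fin, nsmul_eq_mul]
        ring
      -- Keeping only answers off the chains preserves `hR` when `(m, w)` joins `R`.
      have hrest : uniformProb (fun h : Fin P → Word S → Word S =>
            h m w ∉ honest g x (m + 1) ∧ (k (h m w)).Hits (splice g h x) (items g x) t ∧
              ∀ p ∈ R, h p.1 p.2 = h₀ p.1 p.2) ≤
          q * (L / 2 ^ S) * uniformProb (fun h : Fin P → Word S → Word S =>
            ∀ p ∈ R, h p.1 p.2 = h₀ p.1 p.2) := by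
        rw [uniformProb_eq_sum_fiber (fun h => h m w),
          uniformProb_eq_sum_fiber (fun h : Fin P → Word S → Word S => h m w) fun h => ∀ p ∈ R, h p.1 p.2 = h₀ p.1 p.2,
          Finset.mul_sum]
        refine Finset.sum_le_sum fun y _ => ?_
        by_cases hy : y ∈ honest g x (m + 1)
        · rw [uniformProb_false fun h hh => hh.2.1 (by rwa [hh.1])]
          exact mul_nonneg (by positivity) (uniformProb_nonneg _)
        let h₁ : Fin P → Word S → Word S :=
          fun m' w' => if (m', w') = (m, w) then y else h₀ m' w'
        have hiff : ∀ h : Fin P → Word S → Word S,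
            (∀ p ∈ insert (m, w) R, h p.1 p.2 = h₁ p.1 p.2) ↔
              h m w = y ∧ ∀ p ∈ R, h p.1 p.2 = h₀ p.1 p.2 := fun h => by
          rw [Set.forall_mem_insert]
          refine and_congr (by simp [h₁]) (forall_congr' fun p => imp_congr_right fun hp => ?_)
          simp only [h₁]
          rw [if_neg fun hpm : p = (m, w) => hmw (hpm ▸ hp)]
        have := ih y (hA y) (t := t) (insert (m, w) R) h₁ ?_
        · simp only [hiff] at this
          refine le_trans (uniformProb_mono ?_) this
          rintro h ⟨hy, -, hH, hh⟩
          exact ⟨by rwa [hy] at hH, hy, hh⟩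
        · rw [Set.forall_mem_insert]
          refine ⟨fun _ => by simpa [h₁] using hy, fun p hp => ?_⟩
          simp only [h₁]
          rw [if_neg fun hpm : p = (m, w) => hmw (hpm ▸ hp)]
          exact hR p hp
      refine (uniformProb_mono fun h hh => ?_).trans ((uniformProb_or_le _ _).trans
        ((add_le_add hfirst hrest).trans_eq (by push_cast; ring)))
      obtain ⟨hH, hh⟩ := hh
      rw [Attacker.Hits, splice, if_neg hw] at hH
      by_cases hy : h m w ∈ honest g x (m + 1)
      · obtain ⟨j, hj⟩ := hy
        exact Or.inl ⟨j, hj.symm, hh⟩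
      · exact Or.inr ⟨hy, hH.resolve_left fun hH => hy hH.2, hh⟩

theorem uniformProb_hits_le (g : Fin P → Word S → Word S) (x : Fin L → Word S)
    (A : Attacker P S L) {q t : ℕ} (hA : A.AtMost q) :
    uniformProb (fun h : Fin P → Word S → Word S => A.Hits (splice g h x) (items g x) t) ≤
      q * (L / 2 ^ S) := by
  have := uniformProb_hits_and_le g x A (t := t) hA ∅ g (by simp)
  simp only [Set.mem_empty_iff_false, false_imp_iff, implies_true, and_true] at this
  exact this.trans (mul_le_of_le_one_right (by positivity) (uniformProb_le_one _))

/-- The attacker wins against `L` chains with probability at most `L (2 Q + P + 1) / 2 ^ S`. -/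
theorem uniformProb_wins_le (pos : ℕ → ℕ) (A : (Fin L → Word S) → Attacker P S L) {q : ℕ}
    (hA : ∀ v, (A v).AtMost q) :
    uniformProb (fun ω : (Fin P → Word S → Word S) × (Fin L → Word S) =>
      (A (items ω.1 ω.2 P)).Wins pos ω.1 (items ω.1 ω.2) 0) ≤
      (2 * q + P + 1) * (L / 2 ^ S) := by
  rw [uniformProb_splice]
  simp only [items_splice]
  refine (uniformProb_mono fun ω hω => hω.guesses_or_hits).trans ((uniformProb_or_le _ _).trans ?_)
  have hguess : uniformProb (fun ω : (Fin P → Word S → Word S) × (Fin P → Word S → Word S) ×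
      (Fin L → Word S) => (A (items ω.2.1 ω.2.2 P)).Guesses pos ω.1 ω.2.1 ω.2.2 0) ≤
      (q + 1) * (L / 2 ^ S) :=
    uniformProb_prod_le _ (by positivity) fun h => uniformProb_guesses_le pos h A hA
  have hhit : uniformProb (fun ω : (Fin P → Word S → Word S) × (Fin P → Word S → Word S) ×
      (Fin L → Word S) => ((A (items ω.2.1 ω.2.2 P)).verified pos).Hits
        (splice ω.2.1 ω.1 ω.2.2) (items ω.2.1 ω.2.2) 0) ≤ (q + P : ℕ) * (L / 2 ^ S) :=
    uniformProb_prod_le' _ (by positivity) fun ω =>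
      uniformProb_hits_le ω.1 ω.2 ((A (items ω.1 ω.2 P)).verified pos)
        (Attacker.verified_atMost pos _ (hA _))
  refine (add_le_add hguess hhit).trans_eq ?_
  push_cast
  ring

end SmartOTP

namespace SmartOTP

variable {P S K : ℕ}

/-! ### From the scheme to the abstract attack -/

theorem mod_eq_of_subtree {NS δ i : ℕ} (h₁ : δ * NS ≤ i) (h₂ : i < (δ + 1) * NS) :
    i % NS = i - δ * NS ∧ i / NS = δ := by
  rw [add_mul, one_mul] at h₂
  have : i = (i - δ * NS) + δ * NS := by omega
  have hpos : 0 < NS := by omega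
  constructor
  · rw [this, Nat.add_mul_mod_self_right, Nat.mod_eq_of_lt (by omega), Nat.add_sub_cancel]
  · rw [this, Nat.add_mul_div_right _ _ hpos, Nat.div_eq_of_lt (by omega), zero_add]

theorem alpha_eq {L δ i : ℕ} (hP : 0 < P) (h₁ : δ * (P * L) ≤ i) (h₂ : i < (δ + 1) * (P * L)) :
    alpha (P * L) P i = P - (i - δ * (P * L)) / L - 1 := by
  rw [alpha, (mod_eq_of_subtree h₁ h₂).1, mul_comm _ P, Nat.mul_div_mul_left _ _ hP]

theorem beta_eq {L δ i : ℕ} (hP : 0 < P) (h₁ : δ * (P * L) ≤ i) (h₂ : i < (δ + 1) * (P * L)) :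
    beta (P * L) P i = δ * L + i % L := by
  rw [beta, (mod_eq_of_subtree h₁ h₂).2, Nat.mul_div_cancel_left _ hP]

theorem getOTP_layer {L t j : ℕ} (h : Fin P → Word S → Word S) (F : Fin K → Word S) (δ : ℕ)
    (ht : t < P) (hj : j < L) :
    getOTP (P * L) P h F (δ * (P * L) + t * L + j) =
      chain h 0 (P - 1 - t) (head F (δ * L + j)) := by
  have hP : 0 < P := by omega
  have h₃ : (t + 1) * L ≤ P * L := Nat.mul_le_mul_right L ht
  rw [add_mul, one_mul] at h₃
  have h₁ : δ * (P * L) ≤ δ * (P * L) + t * L + j := by omega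
  have h₂ : δ * (P * L) + t * L + j < (δ + 1) * (P * L) := by
    rw [add_mul, one_mul]; omega
  have hlayer : (δ * (P * L) + t * L + j - δ * (P * L)) / L = t := by
    rw [add_assoc, Nat.add_sub_cancel_left, mul_comm, Nat.mul_add_div (by omega),
      Nat.div_eq_of_lt hj, add_zero]
  have hmod : (δ * (P * L) + t * L + j) % L = j := by
    rw [show δ * (P * L) + t * L + j = j + L * (δ * P + t) by ring,
      Nat.add_mul_mod_self_left, Nat.mod_eq_of_lt hj]
  rw [getOTP, alpha_eq hP h₁ h₂, beta_eq hP h₁ h₂, hlayer, hmod, Nat.sub_right_comm]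

/-- After `P` layers the subtree is depleted. Hence in a successful run the subtraction in `P - 1 -
t` never truncates. -/
theorem Attacker.Succeeds.lt {NS δ : ℕ} (hPNS : P ∣ NS) {h : Fin P → Word S → Word S}
    {F : Fin K → Word S} {A : Attacker P S (NS / P)} {t : ℕ}
    (hA : A.Succeeds NS δ h F t) : t < P := by
  induction A generalizing t with
  | forge i z =>
    have := hA.1.trans_lt hA.2.1
    rw [add_mul, one_mul, ← Nat.mul_div_cancel' hPNS] at this
    by_contra! hle
    have hle' := Nat.mul_le_mul_right (NS / P) hle
    rw [Nat.mul_div_cancel' hPNS] at *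
    omega
  | hash m w k ih => exact ih _ hA
  | nextLayer k ih => have := ih _ hA; omega

/-- Layer `t` occupies position `P - 1 - t`, so an undisclosed operation lies below `P - t`. The
requirement of the chain's own leaf is weakened to any leaf of the subtree. -/
theorem Attacker.Succeeds.wins {L δ : ℕ} (hP : 0 < P) (hL : 0 < L)
    {h : Fin P → Word S → Word S} {F : Fin K → Word S} {x : Fin (P * L / P) → Word S}
    (hx : ∀ j : Fin (P * L / P), head F (δ * (P * L / P) + j) = x j)
    {A : Attacker P S (P * L / P)} {t : ℕ} (hA : A.Succeeds (P * L) δ h F t) :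
    A.Wins (alpha (P * L) P) h (items h x) t := by
  have hdiv : P * L / P = L := Nat.mul_div_cancel_left _ hP
  induction A generalizing t with
  | forge i z =>
    obtain ⟨h₁, h₂, hacc⟩ := hA
    rw [hdiv] at h₁
    have h₁' : δ * (P * L) ≤ i := by omega
    have ht : t ≤ (i - δ * (P * L)) / L := by
      rw [Nat.le_div_iff_mul_le hL]
      omega
    have ht' : (i - δ * (P * L)) / L < P := by
      rw [Nat.div_lt_iff_lt_mul hL]
      rw [add_mul, one_mul] at h₂
      omega
    refine ⟨by rw [alpha_eq hP h₁' h₂]; omega,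
      ⟨⟨i % L, hdiv.symm ▸ Nat.mod_lt _ hL⟩, ?_⟩⟩
    rw [hacc, leaf, beta_eq hP h₁' h₂, items, ← hx]
    simp only [hdiv]
  | hash m w k ih => exact ih _ hA
  | nextLayer k ih =>
    have ht : t < P := by
      have := Attacker.Succeeds.lt (dvd_mul_right P L) hA
      exact this
    have hw := ih _ hA
    rw [Attacker.Wins]
    convert hw using 2
    funext j
    have hj : (j : ℕ) < L := j.2.trans_eq hdiv
    rw [items, ← hx]
    simp only [hdiv]
    exact (getOTP_layer h F δ ht hj).symm

/-- Replacing the entries of a family at the values of `e` by those of another family. -/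
noncomputable def exchangeAt {ι κ α : Type*} (e : ι → κ) (ω : (κ → α) × (ι → α)) :
    (κ → α) × (ι → α) :=
  (Function.extend e ω.2 ω.1, fun i => ω.1 (e i))

theorem exchangeAt_involutive {ι κ α : Type*} {e : ι → κ} (he : Function.Injective e) :
    Function.Involutive (exchangeAt (α := α) e) := by
  rintro ⟨F, x⟩
  refine Prod.ext (funext fun c => ?_) (funext fun i => ?_)
  · by_cases hc : ∃ i, e i = c
    · obtain ⟨i, rfl⟩ := hc
      simp [exchangeAt, he.extend_apply]
    · simp [exchangeAt, Function.extend_apply' _ _ _ hc]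
  · simp [exchangeAt, he.extend_apply]

theorem breakProb_le {C : Type*} [Fintype C] {L N Q δ : ℕ} (hP : 0 < P) (hL : 0 < L)
    (hδ : δ * L + L ≤ N / P) (A : Strategy C (P * L) P S δ) (hA : ∀ c l e, (A c l e).AtMost Q) :
    breakProb N (P * L) P S δ A ≤ (2 * Q + P + 1) * (L / 2 ^ S) := by
  have hdiv : P * L / P = L := Nat.mul_div_cancel_left _ hP
  let e : Fin (P * L / P) → Fin (N / P) := fun j => ⟨δ * (P * L / P) + j, by
    have hj := j.2.trans_eq hdiv
    simp only [hdiv]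
    omega⟩
  have he : Function.Injective e := fun a b hab => by
    simp only [e, Fin.mk.injEq] at hab
    exact Fin.ext (by omega)
  refine uniformProb_prod_le _ (by positivity) fun c => ?_
  -- resample the first items of the chains of the subtree
  rw [← uniformProb_snd (α := Fin (P * L / P) → Word S)]
  let Φ : (Fin (N / P) → Word S) × (Fin (P * L / P) → Word S) × (Fin P → Word S → Word S) ≃
      (Fin (P * L / P) → Word S) × (Fin P → Word S → Word S) × (Fin (N / P) → Word S) :=
    (Equiv.prodAssoc _ _ _).symm.trans <|
      ((exchangeAt_involutive he).toPerm.prodCongr (Equiv.refl _)).trans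
        ⟨fun ω => (ω.1.2, ω.2, ω.1.1), fun ω => ((ω.2.2, ω.1), ω.2.1), fun _ => rfl, fun _ => rfl⟩
  rw [← uniformProb_comp_equiv Φ]
  -- The entries of `F` at the chains of the subtree are overwritten by `x`; with `F` fixed, the
  -- heads of the earlier chains are constants.
  refine uniformProb_prod_le _ (by positivity) fun F => ?_
  rw [← uniformProb_comp_equiv (Equiv.prodComm (Fin P → Word S → Word S) _)]
  have hwin := uniformProb_wins_le (P := P) (S := S) (alpha (P * L) P)
    (fun v => A c v fun j => head F j) fun v => hA c v _
  refine le_trans (uniformProb_mono ?_) (hwin.trans_eq (by rw [hdiv]))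
  rintro ⟨h, x⟩ hω
  have hx : ∀ j : Fin (P * L / P),
      head (Function.extend e x F) (δ * (P * L / P) + j) = x j := fun j =>
    (dif_pos (e j).2).trans (he.extend_apply x F j)
  have hearlier : ∀ j : Fin (δ * (P * L / P)), head (Function.extend e x F) j = head F j :=
    fun j => by
      unfold head
      split_ifs
      · refine Function.extend_apply' _ _ _ ?_
        rintro ⟨i, hi⟩
        have := congrArg Fin.val hi
        have := j.2
        simp only [e] at *
        omega
      · rfl
  have hω' : (A c (fun j => leaf h (Function.extend e x F) (δ * (P * L / P) + j))
      fun j => head (Function.extend e x F) j).Succeeds (P * L) δ h (Function.extend e x F) 0 := hω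
  have := hω'.wins hP hL hx
  simp only [leaf, hx, hearlier] at this
  exact this

end SmartOTP

/-! ### Combining the estimates -/

theorem corollary2 {C : Type*} [Fintype C] [Nonempty C]
    (N NS P S lam Q δ : ℕ) (hP : 0 < P) (hNS : 0 < NS) (hPNS : P ∣ NS) (hNSN : NS ∣ N)
    (hδ : δ < N / NS)
    (hS : (lam : ℝ) + 2 + Real.logb 2 ((NS : ℝ) / (P : ℝ)) ≤ (S : ℝ))
    (A : SmartOTP.Strategy C NS P S δ) (hA : ∀ c l e, (A c l e).AtMost Q) :
    SmartOTP.breakProb N NS P S δ A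
        ≤ ((NS : ℝ) / (P : ℝ)) * (2 * (Q : ℝ) + 2 * (P : ℝ) + 1) / 2 ^ S ∧
    SmartOTP.breakProb N NS P S δ A ≤ (2 * (Q : ℝ) + 2 * (P : ℝ) + 1) / 2 ^ (lam + 2) ∧
    ∃ B : Word lam → RandomOracle.Inverter lam,
      (∀ y, (B y).AtMost (max Q P)) ∧
      SmartOTP.breakProb N NS P S δ A ≤ RandomOracle.inversionProb B := by
  obtain ⟨L, rfl⟩ := hPNS
  have hL : 0 < L := Nat.pos_of_mul_pos_left hNS
  have hP' : (0 : ℝ) < P := by exact_mod_cast hP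
  have hL' : (0 : ℝ) < L := by exact_mod_cast hL
  have hcount : δ * L + L ≤ N / P := by
    obtain ⟨d, rfl⟩ := hNSN
    rw [Nat.mul_div_cancel_left _ hNS] at hδ
    rw [mul_assoc, Nat.mul_div_cancel_left _ hP, mul_comm L d, ← Nat.succ_mul]
    exact Nat.mul_le_mul_right L hδ
  have hdiv : ((P * L : ℕ) : ℝ) / P = L := by
    push_cast
    field_simp
  rw [hdiv] at hS ⊢
  have hpow : (2 : ℝ) ^ (lam + 2) * L ≤ 2 ^ S := by
    rw [← Real.rpow_natCast 2 S]
    refine le_trans (le_of_eq ?_) (Real.rpow_le_rpow_of_exponent_le one_le_two hS)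
    rw [Real.rpow_add two_pos, Real.rpow_logb two_pos (by norm_num) hL']
    norm_cast
  have hfirst : SmartOTP.breakProb N (P * L) P S δ A ≤
      L * (2 * (Q : ℝ) + 2 * (P : ℝ) + 1) / 2 ^ S := by
    -- There is slack here: the attack bound has `P` where `2P` is needed.
    refine (SmartOTP.breakProb_le hP hL hcount A hA).trans ?_
    rw [mul_div_assoc', mul_comm (L : ℝ)]
    gcongr
    linarith
  have hsecond : SmartOTP.breakProb N (P * L) P S δ A ≤
      (2 * (Q : ℝ) + 2 * (P : ℝ) + 1) / 2 ^ (lam + 2) := by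
    refine hfirst.trans ?_
    rw [div_le_div_iff₀ (by positivity) (by positivity), mul_comm (L : ℝ), mul_assoc]
    refine mul_le_mul_of_nonneg_left ?_ (by positivity)
    rwa [mul_comm]
  refine ⟨hfirst, hsecond, ?_⟩
  obtain ⟨B, hB, hBprob⟩ := RandomOracle.exists_inverter lam (max Q P)
  refine ⟨B, hB, le_trans (le_min (uniformProb_le_one _) (hsecond.trans ?_)) hBprob⟩
  -- The two extra bits give the factor 4 in `2Q + 2P + 1 ≤ 4 (max Q P + 1)`.
  rw [pow_add, div_le_div_iff₀ (by positivity) (by positivity), ← mul_assoc, mul_right_comm]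
  refine mul_le_mul_of_nonneg_right ?_ (by positivity)
  have h₁ : (Q : ℝ) ≤ (max Q P : ℕ) := by exact_mod_cast le_max_left _ _
  have h₂ : (P : ℝ) ≤ (max Q P : ℕ) := by exact_mod_cast le_max_right _ _
  linarith
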